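/- Let $K$ be a field of prime characteristic $p>2$ with $[K:K^p]<\infty$, let $n\ge 1$, let $S=K[\![x_1,\dots,x_n]\!]$, let $d_1,\dots,d_n$ be positive integers, and let $f=x_1^{d_1}\cdots x_n^{d_n}\in S$. Let $R^\sharp=S[\![z]\!]/(f+z^2)$. For an F-finite Noetherian local ring $R$ of characteristic $p$, with Krull dimension $d_R$ and residue field $k$, let $F^e_*(R)$ be the abelian group $R$ with the $R$-module structure $r\cdot m=r^{p^e}m$, and let $a_e(R)$ be the maximal rank of a free direct summand of the $R$-module $F^e_*(R)$. (F-finite means that $F^1_*(R)$ is a finitely generated $R$-module.) The F-signature of $R$ is $$\mathbb S(R)=\lim_{e\to\infty}\frac{a_e(R)}{p^{e(d_R+\alpha(R))}},\qquad \alpha(R)=\log_p[k:k^p].$$ Then $R^\sharp$ is an F-finite Noetherian local ring of characteristic $p$, its F-signature exists as a limit, and: 1) if $d_j=1$ for all $1\le j\le n$, then $\mathbb S(R^\sharp)=\dfrac{1}{2^{n-1}}$; 2) if $\max\{d_1,\dots,d_n\}\ge 2$, then $\mathbb S(R^\sharp)=0$. -/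

import Mathlib

open scoped Topology

/-- For `R` of prime characteristic `p`, the additive group of `R` carrying the `R`-module
structure obtained by restricting scalars along the `e`-th iterate of the Frobenius. -/
@[nolint unusedArguments]
def FrobeniusPushforward (R : Type*) (_p _e : ℕ) : Type _ := R

instance FrobeniusPushforward.instAddCommGroup (R : Type*) [CommRing R] (p e : ℕ) :
    AddCommGroup (FrobeniusPushforward R p e) :=
  inferInstanceAs (AddCommGroup R)

/-- The module structure is `r • m = r ^ (p ^ e) * m`. -/
noncomputable instance FrobeniusPushforward.instModule (R : Type*) [CommRing R] (p e : ℕ)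
    [Fact p.Prime] [CharP R p] : Module R (FrobeniusPushforward R p e) :=
  Module.compHom R (iterateFrobenius R p e)

theorem FrobeniusPushforward.smul_def {R : Type*} [CommRing R] {p e : ℕ}
    [Fact p.Prime] [CharP R p] (r : R) (m : FrobeniusPushforward R p e) :
    r • m = (show FrobeniusPushforward R p e from r ^ (p ^ e) * (show R from m)) :=
  rfl

/-- The maximal rank of a free direct summand of the `R`-module `M`. -/
noncomputable def maxFreeRank (R M : Type*) [CommRing R] [AddCommGroup M] [Module R M] : ℕ :=
  sSup {r : ℕ | ∃ L N : Submodule R M, IsCompl L N ∧ Nonempty (L ≃ₗ[R] (Fin r → R))}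

/-- A ring of prime characteristic `p` is F-finite if it is a finite module over itself through
the Frobenius. -/
def IsFFinite (p : ℕ) (R : Type*) [CommRing R] [Fact p.Prime] [CharP R p] : Prop :=
  Module.Finite R (FrobeniusPushforward R p 1)

instance residueField_charP (p : ℕ) (R : Type*) [CommRing R] [IsLocalRing R] [Fact p.Prime]
    [CharP R p] : CharP (IsLocalRing.ResidueField R) p := by
  have h : (p : IsLocalRing.ResidueField R) = 0 := by
    rw [← map_natCast (IsLocalRing.residue R) p, CharP.cast_eq_zero, map_zero]
  exact (CharP.charP_iff_prime_eq_zero Fact.out).2 h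

/-- The degree `[k : k ^ p]` of a field `k` of characteristic `p` over its subfield of
`p`-th powers. -/
noncomputable def frobeniusDegree (p : ℕ) (k : Type*) [Field k] [Fact p.Prime] [CharP k p] : ℕ :=
  Module.finrank (frobenius k p).fieldRange k

/-- `HasFSignature p R s` says that `R` is an F-finite Noetherian local ring of prime
characteristic `p` whose F-signature exists and equals `s`: if `d` is the Krull dimension of `R`,
`α` is the logarithm to base `p` of `[k : k ^ p]` for the residue field `k` of `R`, and `a e` is
the maximal rank of a free direct summand of the `e`-th Frobenius pushforward of `R`, then
`a e / p ^ (e * (d + α))` tends to `s`. -/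
def HasFSignature (p : ℕ) [Fact p.Prime] (R : Type*) [CommRing R] (s : ℝ) : Prop :=
  ∃ (_ : IsLocalRing R) (_ : CharP R p) (d : ℕ),
    IsNoetherianRing R ∧ IsFFinite p R ∧ ringKrullDim R = d ∧
      Filter.Tendsto
        (fun e : ℕ => (maxFreeRank R (FrobeniusPushforward R p e) : ℝ) /
          (p : ℝ) ^ ((e : ℝ) *
            (d + Real.logb p (frobeniusDegree p (IsLocalRing.ResidueField R) : ℝ))))
        Filter.atTop (𝓝 s)

/-- The monomial `x_1 ^ d_1 ⋯ x_n ^ d_n` in `K⟦x_1, …, x_n⟧`. -/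
noncomputable def powerSeriesMonomial (K : Type*) [Field K] {n : ℕ} (d : Fin n → ℕ) :
    MvPowerSeries (Fin n) K :=
  ∏ j, MvPowerSeries.X j ^ d j

/-- The hypersurface ring `S⟦z⟧ / (f + z ^ 2)`. -/
abbrev SharpRing {S : Type*} [CommRing S] (f : S) : Type _ :=
  PowerSeries S ⧸ Ideal.span {PowerSeries.C f + (PowerSeries.X : PowerSeries S) ^ 2}

/-! Write `q = p ^ e = 2h + 1`. By Weierstrass division `R = SharpRing f` is `S`-free on `1, z` with
`z² = -f`, so `z` acts on the Frobenius pushforward as multiplication by `z ^ q = (-f) ^ h z`. Over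
`S` the pushforward is free on the `μ_i` and `μ_i z`, where `μ_i` runs over `λ x ^ a` with `0 ≤ a_j
< q` and `λ` in a basis of `K` over `K ^ q`. Dividing `a_j + d_j h` by `q` gives a quotient `α_j ≤
d_j` and a remainder, the exponent of some `μ_{σ i}`. Up to sign, `z` sends `μ_i` to `x ^ α • μ_{σ
i} z`, and `μ_{σ i} z` to `x ^ (d - α) • μ_i`.

Thus the pushforward splits into `R`-modules of rank two over `S`, given by the matrix
factorizations `(x ^ α, x ^ (d - α))` of `f` up to sign. Such a block is `R`-free of rank one if `α
= 0` or `α = d`; otherwise all its functionals land in the maximal ideal (`maxFreeRank_eq_card`).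
Hence `a_e = [K : K ^ p] ^ e * carryCount d q h`, and the degree factor cancels in the limit. If all
`d_j = 1`, the count is `(h + 1) ^ n + h ^ n`, about `2 (q / 2) ^ n`; if some `d_k ≥ 2`, it forces
`a_k = 0` and is at most `q ^ (n - 1)`. -/

/-! ### Free rank of a module split into two-dimensional blocks exchanged by `z`. -/

section FreeRank

variable {S R F K ι : Type*} [CommRing S] [CommRing R] [Algebra S R] [AddCommGroup F] [Module R F]
  [Module S F] [IsScalarTower S R F] [Field K] {z : R} {b : Module.Basis (ι × Bool) S F}
  {A : ι × Bool → S}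

theorem repr_smul_of_swap (hb : ∀ i ε, z • b (i, ε) = A (i, ε) • b (i, !ε)) (x : F) (i : ι)
    (ε : Bool) : b.repr (z • x) (i, ε) = A (i, !ε) * b.repr x (i, !ε) := by
  have key : (b.coord (i, ε)).comp ((LinearMap.lsmul R F z).restrictScalars S) =
      A (i, !ε) • b.coord (i, !ε) := by
    refine b.ext fun ⟨j, δ⟩ => ?_
    classical
    simp only [LinearMap.comp_apply, LinearMap.restrictScalars_apply, LinearMap.lsmul_apply, hb,
      map_smul, Module.Basis.coord_apply, Module.Basis.repr_self, Finsupp.single_apply,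
      LinearMap.smul_apply, smul_eq_mul, Prod.mk.injEq]
    by_cases h : j = i
    · subst h
      cases δ <;> cases ε <;> simp
    · simp [h]
  simpa using LinearMap.congr_fun key x

/-- If `z` sends a vector `u` to a multiple `s • w` and `w` to a multiple of `u`, then functionals
take `u` into any prime `ker π` containing `z` and `s`. -/
theorem map_functional_eq_zero {π : R →+* K} {c s : S} (hzz : z * z = algebraMap S R c)
    (hspan : ∀ r : R, ∃ a b : S, r = algebraMap S R a + algebraMap S R b * z)
    (hindep : ∀ a b : S, algebraMap S R a + algebraMap S R b * z = 0 → a = 0 ∧ b = 0)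
    (hz : π z = 0) {u w : F} (hu : z • u = s • w) (hs : π (algebraMap S R s) = 0)
    (φ : F →ₗ[R] R) : π (φ u) = 0 := by
  obtain ⟨a, a', ha⟩ := hspan (φ u)
  obtain ⟨t, t', ht⟩ := hspan (φ w)
  have h1 : z * φ u = algebraMap S R s * φ w := by
    rw [← smul_eq_mul, ← map_smul, hu, ← algebraMap_smul R s w, map_smul, smul_eq_mul]
  rw [ha, ht] at h1
  -- Comparing the coefficients of `z` gives `a = s t'`, so `φ u = s t' + a' z` dies under `π`.
  have h2 := (hindep (a' * c - s * t) (a - s * t') (by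
    simp only [map_sub, map_mul, ← hzz]
    linear_combination h1)).2
  rw [ha, sub_eq_zero.1 h2]
  simp [hz, hs]

/-- If `A (i, ε)` is a unit, `b (i, !ε)` is a multiple of `z • b (i, ε)`, so block `i` is `R`-free
on `b (i, ε)`. The blocks outside `G` contribute nothing to functionals modulo `ker π`, so a free
summand of rank `s` yields a `K`-linear surjection from `G → K` onto `Fin s → K`. -/
theorem maxFreeRank_eq_card [Finite ι] {π : R →+* K} (hπ : Function.Surjective π) {c : S}
    (hzz : z * z = algebraMap S R c)
    (hspan : ∀ r : R, ∃ a b : S, r = algebraMap S R a + algebraMap S R b * z)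
    (hindep : ∀ a b : S, algebraMap S R a + algebraMap S R b * z = 0 → a = 0 ∧ b = 0)
    (hz : π z = 0) (hb : ∀ i ε, z • b (i, ε) = A (i, ε) • b (i, !ε)) (G : Finset ι)
    (hG : ∀ i ∈ G, ∃ ε, IsUnit (A (i, ε)))
    (hG' : ∀ i ∉ G, ∀ ε, π (algebraMap S R (A (i, ε))) = 0) :
    maxFreeRank R F = G.card := by
  classical
  have := Fintype.ofFinite ι
  have hG2 : ∀ i : G, ∃ ε, IsUnit (A (i, ε)) := fun i => hG i i.2
  choose ε hε using hG2
  choose re im hre using hspan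
  have repr_smul (r : R) (x : F) (i : ι) (δ : Bool) : b.repr (r • x) (i, δ) =
      re r * b.repr x (i, δ) + im r * (A (i, !δ) * b.repr x (i, !δ)) := by
    conv_lhs => rw [hre r]
    rw [add_smul, mul_smul, algebraMap_smul, algebraMap_smul, map_add, map_smul, map_smul]
    simp [repr_smul_of_swap hb]
  -- The complement of the free part: the sum of the blocks outside `G`.
  let N : Submodule R F :=
    { carrier := {x | ∀ i ∈ G, ∀ δ, b.repr x (i, δ) = 0}
      add_mem' := fun {x y} hx hy i hi δ => by simp [hx i hi, hy i hi]
      zero_mem' := by simp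
      smul_mem' := fun r x hx i hi δ => by simp [repr_smul, hx i hi] }
  let g : G → F := fun i => b (i, ε i)
  let Ψ : (G → R) →ₗ[R] F := Fintype.linearCombination R g
  have hΨ1 (v : G → R) (i : G) : b.repr (Ψ v) (i, ε i) = re (v i) := by
    simp only [Ψ, Fintype.linearCombination_apply, map_sum, Finsupp.coe_finsetSum,
      Finset.sum_apply, repr_smul, g]
    rw [Finset.sum_eq_single i]
    · simp
    · intro j _ hj
      have : (j : ι) ≠ i := fun h => hj (Subtype.ext h)
      simp [this]
    · simp
  have hΨ2 (v : G → R) (i : G) : b.repr (Ψ v) (i, !ε i) = im (v i) * A (i, ε i) := by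
    simp only [Ψ, Fintype.linearCombination_apply, map_sum, Finsupp.coe_finsetSum,
      Finset.sum_apply, repr_smul, g]
    rw [Finset.sum_eq_single i]
    · simp
    · intro j _ hj
      have : (j : ι) ≠ i := fun h => hj (Subtype.ext h)
      simp [this]
    · simp
  have hΨN (v : G → R) (hv : Ψ v ∈ N) : v = 0 := by
    funext i
    have h1 := hv i i.2 (ε i)
    have h2 := hv i i.2 (!ε i)
    rw [hΨ1] at h1
    rw [hΨ2, (hε i).mul_left_eq_zero] at h2
    rw [hre (v i), h1, h2]
    simp
  have hinj : Function.Injective Ψ := by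
    rw [injective_iff_map_eq_zero]
    intro v hv
    exact hΨN v (hv ▸ N.zero_mem)
  have hother (i : ι) (hi : i ∈ G) (δ : Bool) (h : δ ≠ ε ⟨i, hi⟩) :
      ∃ a : R, b (i, δ) = a • z • b (i, ε ⟨i, hi⟩) := by
    obtain ⟨a, ha⟩ := hε ⟨i, hi⟩
    refine ⟨algebraMap S R (↑a⁻¹ : S), ?_⟩
    rw [hb, algebraMap_smul, ← Bool.eq_not.2 h, ← ha, smul_smul, Units.inv_mul, one_smul]
  have hcompl : IsCompl (LinearMap.range Ψ) N := by
    constructor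
    · rw [Submodule.disjoint_def]
      rintro _ ⟨v, rfl⟩ hv
      rw [hΨN v hv, map_zero]
    · rw [codisjoint_iff, eq_top_iff]
      intro x _
      have : ⊤ ≤ (LinearMap.range Ψ ⊔ N).restrictScalars S := by
        rw [← b.span_eq, Submodule.span_le]
        rintro _ ⟨⟨i, δ⟩, rfl⟩
        rw [SetLike.mem_coe, Submodule.restrictScalars_mem]
        by_cases hi : i ∈ G
        · have hg : b (i, ε ⟨i, hi⟩) ∈ LinearMap.range Ψ :=
            ⟨Pi.single ⟨i, hi⟩ 1, by simp [Ψ, g, Fintype.linearCombination_apply_single]⟩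
          apply Submodule.mem_sup_left
          by_cases hδ : δ = ε ⟨i, hi⟩
          · exact hδ ▸ hg
          · obtain ⟨a, ha⟩ := hother i hi δ hδ
            rw [ha]
            exact Submodule.smul_mem _ _ (Submodule.smul_mem _ _ hg)
        · apply Submodule.mem_sup_right
          intro j hj δ'
          have : i ≠ j := fun h => hi (h ▸ hj)
          simp [this]
      exact this (Submodule.mem_top)
  have hfun (φ : F →ₗ[R] R) (i : ι) (δ : Bool) (h : ∀ hi : i ∈ G, δ ≠ ε ⟨i, hi⟩) :
      π (φ (b (i, δ))) = 0 := by
    by_cases hi : i ∈ G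
    · obtain ⟨a, ha⟩ := hother i hi δ (h hi)
      rw [ha, φ.map_smul, φ.map_smul, smul_eq_mul, smul_eq_mul, map_mul, map_mul, hz, zero_mul,
        mul_zero]
    · exact map_functional_eq_zero hzz (fun r => ⟨re r, im r, hre r⟩) hindep hz (hb i δ)
        (hG' i hi δ) φ
  -- Modulo `ker π`, a functional sees only the coordinates of `x` on the free generators.
  have hsum (φ : F →ₗ[R] R) (x : F) : π (φ x) =
      ∑ i : G, π (algebraMap S R (b.repr x (i, ε i))) * π (φ (g i)) := by
    conv_lhs => rw [← b.sum_repr x]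
    rw [map_sum, map_sum]
    have : ∀ k, π (φ (b.repr x k • b k)) =
        π (algebraMap S R (b.repr x k)) * π (φ (b k)) := by
      intro k
      rw [← algebraMap_smul R, map_smul, smul_eq_mul, map_mul]
    simp only [this]
    symm
    refine Finset.sum_of_injOn (fun i : G => ((i : ι), ε i)) ?_ (by simp) ?_ (by simp [g])
    · intro i _ j _ h
      exact Subtype.ext (Prod.ext_iff.1 h).1
    · rintro ⟨i, δ⟩ _ h
      rw [hfun φ i δ, mul_zero]
      rintro hi rfl
      exact h ⟨⟨i, hi⟩, by simp, rfl⟩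
  -- The bound on ranks is needed twice: as the upper estimate and as boundedness of the set,
  -- without which `sSup` carries no information.
  refine le_antisymm (csSup_le ⟨G.card, ?_⟩ ?_) (le_csSup ⟨G.card, ?_⟩ ?_)
  case refine_2 | refine_3 =>
    rintro s ⟨L', N', h, ⟨e⟩⟩
    let φ : F →ₗ[R] (Fin s → R) := e.toLinearMap ∘ₗ Submodule.projectionOnto L' N' h
    have hφ : Function.Surjective φ :=
      e.surjective.comp (Submodule.projectionOnto_surjective h)
    let T : (G → K) →ₗ[K] (Fin s → K) :=
      Fintype.linearCombination K fun i k => π (φ (g i) k)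
    have hT : Function.Surjective T := by
      intro y
      choose Y hY using fun k => hπ (y k)
      obtain ⟨x, hx⟩ := hφ Y
      refine ⟨fun i => π (algebraMap S R (b.repr x (i, ε i))), ?_⟩
      funext k
      have := hsum (LinearMap.proj k ∘ₗ φ) x
      simp only [LinearMap.comp_apply, LinearMap.proj_apply, hx, hY] at this
      simp [T, Fintype.linearCombination_apply, Finset.sum_apply, this]
    simpa using LinearMap.finrank_le_finrank_of_surjective (f := T) hT
  all_goals
    refine ⟨_, N, hcompl, ⟨?_⟩⟩
    exact (LinearEquiv.ofInjective Ψ hinj).symm ≪≫ₗ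
      LinearEquiv.funCongrLeft R R (G.equivFin.symm)

end FreeRank

/-! ### The hypersurface ring is free over `S` on `1, z`. -/

section SharpRing

open Polynomial in
theorem isDistinguishedAt_X_sq_add_C {S : Type*} [CommRing S] [Nontrivial S] {I : Ideal S} {f : S}
    (hf : f ∈ I) : (X ^ 2 + C f : S[X]).IsDistinguishedAt I where
  monic := monic_X_pow_add_C f two_ne_zero
  mem {n} hn := by
    rw [natDegree_X_pow_add_C] at hn
    interval_cases n
    · simpa
    · simp

namespace SharpRing

variable {S : Type*} [CommRing S] {f : S}

/-- The class of the variable `z` in `S⟦z⟧ / (f + z ^ 2)`. -/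
noncomputable def root (f : S) : SharpRing f := Ideal.Quotient.mk _ PowerSeries.X

theorem root_mul_root (f : S) : root f * root f = algebraMap S (SharpRing f) (-f) := by
  have h : (Ideal.Quotient.mk (Ideal.span {PowerSeries.C f + (PowerSeries.X : PowerSeries S) ^ 2}))
      (PowerSeries.C f + PowerSeries.X ^ 2) = 0 :=
    Ideal.Quotient.eq_zero_iff_mem.2 (Ideal.mem_span_singleton_self _)
  have h2 : algebraMap S (SharpRing f) f = Ideal.Quotient.mk _ (PowerSeries.C f) := rfl
  rw [map_neg, h2]
  rw [map_add, map_pow] at h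
  rw [root]
  linear_combination h

variable [Nontrivial S] (I : Ideal S) [IsAdicComplete I S]

/-- Weierstrass division by `f + z ^ 2`: power series may be replaced by polynomials in `z`. -/
noncomputable def polynomialEquiv (hf : f ∈ I) :
    (Polynomial S ⧸ Ideal.span {Polynomial.X ^ 2 + Polynomial.C f}) ≃ₐ[S] SharpRing f :=
  (isDistinguishedAt_X_sq_add_C hf).algEquivQuotient.trans
    (Ideal.quotientEquivAlgOfEq S (by simp [add_comm]))

theorem polynomialEquiv_mk (hf : f ∈ I) (P : Polynomial S) :
    polynomialEquiv I hf (Ideal.Quotient.mk _ P) = Ideal.Quotient.mk _ (P : PowerSeries S) :=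
  rfl

theorem polynomialEquiv_linear (hf : f ∈ I) (a b : S) :
    polynomialEquiv I hf (Ideal.Quotient.mk _ (Polynomial.C a + Polynomial.C b * Polynomial.X)) =
      algebraMap S _ a + algebraMap S _ b * root f := by
  rw [polynomialEquiv_mk]
  simp only [Polynomial.coe_add, Polynomial.coe_mul, Polynomial.coe_C, Polynomial.coe_X, map_add,
    map_mul]
  rfl

/-- Once power series in `z` are replaced by polynomials, the remainder modulo the monic quadratic
is linear. -/
theorem exists_eq_add_mul_root (hf : f ∈ I) (r : SharpRing f) :
    ∃ a b : S, r = algebraMap S _ a + algebraMap S _ b * root f := by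
  obtain ⟨Q, rfl⟩ := (polynomialEquiv I hf).surjective r
  obtain ⟨P, rfl⟩ := Ideal.Quotient.mk_surjective Q
  set g : Polynomial S := Polynomial.X ^ 2 + Polynomial.C f with hg
  have hmonic : g.Monic := (isDistinguishedAt_X_sq_add_C hf).monic
  have hdeg : (P %ₘ g).degree ≤ 1 := by
    have h := Polynomial.degree_modByMonic_lt P hmonic
    rw [hg, Polynomial.degree_X_pow_add_C two_pos] at h
    exact Order.le_of_lt_succ h
  obtain ⟨a, b, hab⟩ : ∃ a b : S, P %ₘ g = Polynomial.C b * Polynomial.X + Polynomial.C a :=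
    ⟨_, _, Polynomial.eq_X_add_C_of_degree_le_one hdeg⟩
  refine ⟨a, b, ?_⟩
  rw [← polynomialEquiv_linear I hf]
  congr 1
  rw [Ideal.Quotient.eq, Ideal.mem_span_singleton]
  refine ⟨P /ₘ g, ?_⟩
  rw [add_comm (Polynomial.C a), ← hab]
  linear_combination -Polynomial.modByMonic_add_div P g

theorem eq_zero_of_add_mul_root (hf : f ∈ I) (a b : S)
    (h : algebraMap S (SharpRing f) a + algebraMap S _ b * root f = 0) : a = 0 ∧ b = 0 := by
  rw [← polynomialEquiv_linear I hf, EmbeddingLike.map_eq_zero_iff,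
    Ideal.Quotient.eq_zero_iff_mem, Ideal.mem_span_singleton] at h
  have hmonic := (isDistinguishedAt_X_sq_add_C hf).monic
  have h0 : Polynomial.C a + Polynomial.C b * Polynomial.X = 0 := by
    by_contra h0
    refine hmonic.not_dvd_of_natDegree_lt h0 ?_ h
    rw [Polynomial.natDegree_X_pow_add_C, add_comm]
    exact (Polynomial.natDegree_linear_le).trans_lt one_lt_two
  exact ⟨by simpa using congrArg (Polynomial.coeff · 0) h0,
    by simpa using congrArg (Polynomial.coeff · 1) h0⟩

end SharpRing

end SharpRing

/-! ### Krull dimension of power series rings and of the hypersurface. -/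

section Dimension

/-- The variable is a nonzerodivisor in the Jacobson radical, so killing it lowers the dimension by
exactly one. -/
theorem ringKrullDim_powerSeries {A : Type*} [CommRing A] [IsDomain A] [IsLocalRing A]
    [IsNoetherianRing A] :
    ringKrullDim (PowerSeries A) = ringKrullDim A + 1 := by
  refine le_antisymm ?_ ringKrullDim_succ_le_ringKrullDim_powerseries
  have hX : (PowerSeries.X : PowerSeries A) ∈ Ring.jacobson (PowerSeries A) := by
    rw [IsLocalRing.ringJacobson_eq_maximalIdeal, IsLocalRing.mem_maximalIdeal, mem_nonunits_iff,
      PowerSeries.isUnit_iff_constantCoeff]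
    simp
  have h := ringKrullDim_quotient_span_singleton_succ_eq_ringKrullDim_of_mem_jacobson
    (R := PowerSeries A) (x := PowerSeries.X)
    (fun a b hab => mul_left_cancel₀ PowerSeries.X_ne_zero hab) hX
  rw [← h]
  gcongr
  have hker : Ideal.span {PowerSeries.X} = RingHom.ker (PowerSeries.constantCoeff (R := A)) := by
    ext x
    rw [Ideal.mem_span_singleton, PowerSeries.X_dvd_iff, RingHom.mem_ker]
  refine (ringKrullDim_eq_of_ringEquiv ?_).le
  rw [hker]
  exact RingHom.quotientKerEquivOfSurjective PowerSeries.constantCoeff_surj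

theorem ringKrullDim_mvPowerSeries_fin (K : Type*) [Field K] (n : ℕ) :
    ringKrullDim (MvPowerSeries (Fin n) K) = n := by
  induction n with
  | zero =>
    rw [ringKrullDim_eq_of_ringEquiv (MvPowerSeries.isEmptyEquiv (Fin 0) K).toRingEquiv]
    simp
  | succ n ih =>
    have : IsDomain (MvPowerSeries (Fin n) K) := NoZeroDivisors.to_isDomain _
    rw [ringKrullDim_eq_of_ringEquiv (MvPowerSeries.finSuccEquiv K n).toRingEquiv,
      ringKrullDim_powerSeries, ih]
    simp

theorem ringKrullDim_sharpRing {S : Type*} [CommRing S] [IsDomain S] [IsLocalRing S]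
    [IsNoetherianRing S] {f : S} (hf : f ∈ IsLocalRing.maximalIdeal S) :
    ringKrullDim (SharpRing f) = ringKrullDim S := by
  have hne : PowerSeries.C f + (PowerSeries.X : PowerSeries S) ^ 2 ≠ 0 := fun h => by
    simpa [PowerSeries.coeff_C, PowerSeries.coeff_X_pow] using
      congrArg (PowerSeries.coeff 2) h
  have h := ringKrullDim_quotient_span_singleton_succ_eq_ringKrullDim_of_mem_jacobson
    (R := PowerSeries S) (x := PowerSeries.C f + PowerSeries.X ^ 2)
    (fun a b hab => mul_left_cancel₀ hne hab) ?_
  · rw [ringKrullDim_powerSeries] at h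
    exact ENat.WithBot.add_one_cancel.1 h
  · rw [IsLocalRing.ringJacobson_eq_maximalIdeal, IsLocalRing.mem_maximalIdeal, mem_nonunits_iff,
      PowerSeries.isUnit_iff_constantCoeff]
    simpa using hf

end Dimension

/-! ### The degree of a field over its `p ^ e`-th powers. -/

section FrobeniusDegree

variable (p : ℕ) [Fact p.Prime]

theorem frobeniusDegree_congr {k k' : Type*} [Field k] [Field k'] [CharP k p] [CharP k' p]
    (e : k ≃+* k') : frobeniusDegree p k = frobeniusDegree p k' := by
  have h : (frobenius k p).fieldRange.map (e : k →+* k') = (frobenius k' p).fieldRange := by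
    rw [RingHom.fieldRange_eq_map, RingHom.fieldRange_eq_map, Subfield.map_map,
      RingHom.frobenius_comm, ← Subfield.map_map, ← RingHom.fieldRange_eq_map,
      RingHom.fieldRange_eq_top_iff.2 e.surjective]
  have htop : (⊤ : Subfield k).map (e : k →+* k') = ⊤ := by
    rw [← RingHom.fieldRange_eq_map, RingHom.fieldRange_eq_top_iff.2 e.surjective]
  rw [frobeniusDegree, frobeniusDegree, ← Subfield.relfinrank_top_right,
    ← Subfield.relfinrank_top_right, ← h, ← htop, Subfield.relfinrank_map_map]

variable (K : Type*) [Field K] [CharP K p]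

/-- In the tower `K ^ (p ^ (e + 1)) ⊆ K ^ p ⊆ K`, the lower step is the Frobenius image of `K ^ (p ^
e) ⊆ K`, so degrees multiply. -/
theorem finrank_iterateFrobenius_fieldRange (e : ℕ) :
    Module.finrank (iterateFrobenius K p e).fieldRange K = frobeniusDegree p K ^ e := by
  induction e with
  | zero =>
    have : (iterateFrobenius K p 0).fieldRange = ⊤ :=
      RingHom.fieldRange_eq_top_iff.2 fun x => ⟨x, by simp⟩
    rw [this, pow_zero, ← Subfield.relfinrank_top_right, Subfield.relfinrank_self]
  | succ e ih =>
    have hmap : (iterateFrobenius K p (e + 1)).fieldRange =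
        (iterateFrobenius K p e).fieldRange.map (frobenius K p) := by
      rw [RingHom.fieldRange_eq_map, RingHom.fieldRange_eq_map, Subfield.map_map]
      congr 1
      ext x
      simp [iterateFrobenius_def, frobenius_def, pow_succ, pow_mul]
    have hmap' : (frobenius K p).fieldRange = (⊤ : Subfield K).map (frobenius K p) :=
      RingHom.fieldRange_eq_map _
    have hle : (iterateFrobenius K p (e + 1)).fieldRange ≤ (frobenius K p).fieldRange := by
      rw [hmap, hmap']
      exact (Subfield.gc_map_comap _).monotone_l le_top
    rw [← Subfield.relfinrank_mul_finrank_top hle, hmap, hmap', Subfield.relfinrank_map_map,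
      Subfield.relfinrank_top_right, ih, ← hmap', pow_succ, frobeniusDegree]

theorem frobeniusDegree_pos [FiniteDimensional (frobenius K p).fieldRange K] :
    0 < frobeniusDegree p K :=
  Module.finrank_pos

/-- A basis of `K` over its subfield of `p ^ e`-th powers. -/
theorem exists_basis_iterateFrobenius [FiniteDimensional (frobenius K p).fieldRange K] (e : ℕ) :
    ∃ l : Fin (frobeniusDegree p K ^ e) → K,
      Function.Bijective fun c : Fin (frobeniusDegree p K ^ e) → K =>
        ∑ i, c i ^ p ^ e * l i := by
  have hfin := finrank_iterateFrobenius_fieldRange p K e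
  have : Module.Finite (iterateFrobenius K p e).fieldRange K :=
    Module.finite_of_finrank_pos (hfin ▸ pow_pos (frobeniusDegree_pos p K) e)
  let b := (Module.finBasisOfFinrankEq _ K hfin)
  let φ : K ≃+* (iterateFrobenius K p e).fieldRange :=
    RingEquiv.ofBijective (iterateFrobenius K p e).rangeRestrictField
      ⟨(iterateFrobenius K p e).rangeRestrictField.injective,
        (iterateFrobenius K p e).rangeRestrictField_bijective.2⟩
  refine ⟨b, ?_⟩
  -- Coefficients in the subfield are parametrized by their unique `p ^ e`-th roots in `K`.
  have := b.equivFun.symm.bijective.comp (Equiv.piCongrRight fun _ => φ.toEquiv).bijective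
  convert! this using 1
  funext c
  simp only [Function.comp_apply, Module.Basis.equivFun_symm_apply, Subfield.smul_def]
  rfl

end FrobeniusDegree

/-! ### Power series over their `p ^ e`-th powers. -/

section PowerSeriesBasis

variable {p : ℕ} [Fact p.Prime] {K : Type*} [Field K] [CharP K p] {n : ℕ} {e : ℕ}

/-- The series `c ^ p ^ e` is supported on exponents divisible by `p ^ e`, where its coefficients
are the `p ^ e`-th powers of those of `c`; the monomial factor selects one residue class. -/
theorem coeff_pow_mul_monomial (c : MvPowerSeries (Fin n) K) (a : Fin n → Fin (p ^ e)) (l : K)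
    (m : Fin n →₀ ℕ) :
    MvPowerSeries.coeff m (c ^ p ^ e *
      MvPowerSeries.monomial (Finsupp.equivFunOnFinite.symm fun j => (a j : ℕ)) l) =
    if ∀ j, m j % p ^ e = a j then
      MvPowerSeries.coeff (Finsupp.equivFunOnFinite.symm fun j => m j / p ^ e) c ^ p ^ e * l
    else 0 := by
  have hp0 : p ≠ 0 := (Fact.out : p.Prime).ne_zero
  have hq0 : p ^ e ≠ 0 := pow_ne_zero e hp0
  have hpow (k : Fin n →₀ ℕ) : MvPowerSeries.coeff k (c ^ p ^ e) =
      MvPowerSeries.coeff k (MvPowerSeries.expand (p ^ e) hq0 c) ^ p ^ e := by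
    rw [← MvPowerSeries.map_iterateFrobenius_expand p hp0 c e, MvPowerSeries.coeff_map,
      iterateFrobenius_def]
  split_ifs with h
  · have hm : m = p ^ e • (Finsupp.equivFunOnFinite.symm fun j => m j / p ^ e) +
        Finsupp.equivFunOnFinite.symm fun j => (a j : ℕ) := by
      ext j
      simp [← h j, Nat.div_add_mod]
    conv_lhs => rw [hm]
    rw [MvPowerSeries.coeff_add_mul_monomial, hpow, MvPowerSeries.coeff_expand_smul]
  · rw [MvPowerSeries.coeff_mul_monomial]
    split_ifs with hle
    · push Not at h
      obtain ⟨j, hj⟩ := h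
      rw [hpow, MvPowerSeries.coeff_expand_of_not_dvd _ _ _ (i := j), zero_pow hq0, zero_mul]
      intro hdvd
      apply hj
      have hlej : (a j : ℕ) ≤ m j := by simpa using hle j
      have h1 : (a j : ℕ) ≡ m j [MOD p ^ e] := (Nat.modEq_iff_dvd' hlej).2 (by simpa using hdvd)
      rw [← h1, Nat.mod_eq_of_lt (a j).2]
    · rfl

/-- `K⟦x_1, …, x_n⟧` is free over its subring of `p ^ e`-th powers. -/
theorem bijective_sum_pow_mul_monomial {ι : Type*} [Fintype ι] {l : ι → K}
    (hl : Function.Bijective fun c : ι → K => ∑ i, c i ^ p ^ e * l i) :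
    Function.Bijective fun c : ι × (Fin n → Fin (p ^ e)) → MvPowerSeries (Fin n) K =>
      ∑ i, c i ^ p ^ e * MvPowerSeries.monomial
        (Finsupp.equivFunOnFinite.symm fun j => (i.2 j : ℕ)) (l i.1) := by
  have hq0 : 0 < p ^ e := pow_pos (Fact.out : p.Prime).pos e
  let r : (Fin n →₀ ℕ) → Fin n → Fin (p ^ e) := fun m j => ⟨m j % p ^ e, Nat.mod_lt _ hq0⟩
  let d : (Fin n →₀ ℕ) → (Fin n →₀ ℕ) := fun m =>
    Finsupp.equivFunOnFinite.symm fun j => m j / p ^ e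
  let s : (Fin n →₀ ℕ) → (Fin n → Fin (p ^ e)) → (Fin n →₀ ℕ) := fun m a =>
    Finsupp.equivFunOnFinite.symm fun j => p ^ e * m j + a j
  have hrs (m a) : r (s m a) = a := by
    funext j
    ext
    simp [r, s, Nat.mod_eq_of_lt]
  have hds (m a) : d (s m a) = m := by
    ext j
    simp [d, s, Nat.mul_add_div hq0]
  have hsr (m) : s (d m) (r m) = m := by
    ext j
    simp [d, s, r, Nat.div_add_mod]
  -- Only the residue class `r m` contributes to the coefficient at `m`, which reduces bijectivity
  -- to `hl`, one coefficient at a time.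
  have hcoeff (c : ι × (Fin n → Fin (p ^ e)) → MvPowerSeries (Fin n) K) (m : Fin n →₀ ℕ) :
      MvPowerSeries.coeff m (∑ i, c i ^ p ^ e * MvPowerSeries.monomial
        (Finsupp.equivFunOnFinite.symm fun j => (i.2 j : ℕ)) (l i.1)) =
      ∑ i, MvPowerSeries.coeff (d m) (c (i, r m)) ^ p ^ e * l i := by
    rw [map_sum, Fintype.sum_prod_type]
    refine Finset.sum_congr rfl fun i _ => ?_
    simp only [coeff_pow_mul_monomial]
    have (a : Fin n → Fin (p ^ e)) : (∀ j, m j % p ^ e = a j) ↔ a = r m := by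
      constructor
      · intro h
        funext j
        ext
        exact (h j).symm
      · rintro rfl j
        rfl
    simp only [this, Finset.sum_ite_eq', Finset.mem_univ, if_true]
    rfl
  constructor
  · intro c c' h
    funext ⟨i, a⟩
    ext m
    have h1 := congrArg (MvPowerSeries.coeff (s m a)) h
    simp only [hcoeff, hrs, hds] at h1
    exact congrFun (hl.1 h1) i
  · intro g
    choose y hy using hl.2
    let c : ι × (Fin n → Fin (p ^ e)) → MvPowerSeries (Fin n) K :=
      fun i m => y (MvPowerSeries.coeff (s m i.2) g) i.1
    have hc (i m) : MvPowerSeries.coeff m (c i) = y (MvPowerSeries.coeff (s m i.2) g) i.1 := rfl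
    refine ⟨c, ?_⟩
    ext m
    refine (hcoeff c m).trans ?_
    simp only [hc, hsr]
    exact hy (MvPowerSeries.coeff m g)

end PowerSeriesBasis

/-! ### An `S`-basis of the Frobenius pushforward. -/

section PushforwardBasis

variable {p : ℕ} [Fact p.Prime] {S R ι : Type*} [CommRing S] [CommRing R] [Algebra S R]
  [CharP R p] {e : ℕ}

/-- If `R` is free over `S` on `1, z` and `S` is free over its subring of `p ^ e`-th powers on `μ`,
then the `e`-th Frobenius pushforward of `R` is free over `S` on the `μ i` and `μ (σ i) * z`. -/
theorem exists_basis_frobeniusPushforward [Fintype ι] {z : R}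
    (hspan : ∀ r : R, ∃ a b : S, r = algebraMap S R a + algebraMap S R b * z)
    (hindep : ∀ a b : S, algebraMap S R a + algebraMap S R b * z = 0 → a = 0 ∧ b = 0)
    {μ : ι → S} (hμ : Function.Bijective fun c : ι → S => ∑ i, c i ^ p ^ e * μ i)
    (σ : Equiv.Perm ι) [Module S (FrobeniusPushforward R p e)]
    [IsScalarTower S R (FrobeniusPushforward R p e)] :
    ∃ b : Module.Basis (ι × Bool) S (FrobeniusPushforward R p e),
      (∀ i, b (i, false) = (algebraMap S R (μ i) : R)) ∧
      ∀ i, b (i, true) = (algebraMap S R (μ (σ i)) * z : R) := by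
  have hq0 : p ^ e ≠ 0 := pow_ne_zero e (Fact.out : p.Prime).ne_zero
  let v : ι × Bool → FrobeniusPushforward R p e := fun k =>
    bif k.2 then (algebraMap S R (μ (σ k.1)) * z : R) else (algebraMap S R (μ k.1) : R)
  have hsmul (s : S) (m : R) : (s • (show FrobeniusPushforward R p e from m)) =
      (algebraMap S R s ^ p ^ e * m : R) := by
    rw [← algebraMap_smul R s]
    rfl
  -- The combination separates into its `1`-part and its `z`-part, the latter reindexed by `σ`; each
  -- is then governed by `hμ`.
  have hv (c : ι × Bool → S) : Fintype.linearCombination S v c =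
      (algebraMap S R (∑ i, c (i, false) ^ p ^ e * μ i) +
        algebraMap S R (∑ i, c (σ.symm i, true) ^ p ^ e * μ i) * z : R) := by
    rw [Fintype.linearCombination_apply, Fintype.sum_prod_type]
    simp only [Fintype.sum_bool]
    rw [← Equiv.sum_comp σ fun i => c (σ.symm i, true) ^ p ^ e * μ i, map_sum, map_sum,
      Finset.sum_mul, add_comm, ← Finset.sum_add_distrib]
    refine Finset.sum_congr rfl fun i _ => ?_
    simp only [Equiv.symm_apply_apply, map_mul, map_pow, mul_assoc]
    exact congrArg₂ (fun x y : R => x + y) (hsmul (c (i, true)) (algebraMap S R (μ (σ i)) * z))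
      (hsmul (c (i, false)) (algebraMap S R (μ i)))
  have hzero {c : ι → S} (hc : ∑ i, c i ^ p ^ e * μ i = 0) : c = 0 :=
    hμ.1 (hc.trans (by simp [zero_pow hq0]))
  have hbij : Function.Bijective (Fintype.linearCombination S v) := by
    constructor
    · rw [injective_iff_map_eq_zero]
      intro c hc
      obtain ⟨h1, h2⟩ := hindep _ _ ((hv c).symm.trans hc)
      funext ⟨i, δ⟩
      cases δ
      · exact congrFun (hzero (c := fun i => c (i, false)) h1) i
      · simpa using congrFun (hzero (c := fun i => c (σ.symm i, true)) h2) (σ i)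
    · intro x
      obtain ⟨a, b, hab⟩ := hspan x
      obtain ⟨s, hs⟩ := hμ.2 a
      obtain ⟨t, ht⟩ := hμ.2 b
      refine ⟨fun k => bif k.2 then t (σ k.1) else s k.1, (hv _).trans ?_⟩
      simp only [cond_true, cond_false, Equiv.apply_symm_apply]
      rw [hab, ← hs, ← ht]
  classical
  let b := Module.Basis.ofEquivFun (LinearEquiv.ofBijective _ hbij).symm
  have hb (k) : b k = v k := by
    simp [b, Fintype.linearCombination_apply_single]
  exact ⟨b, fun i => hb (i, false), fun i => hb (i, true)⟩

end PushforwardBasis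

/-! ### The monomial `f` and the residue map to `K`. -/

section Monomial

variable {K : Type*} [Field K] {n : ℕ}

theorem powerSeriesMonomial_eq_monomial (d : Fin n → ℕ) :
    powerSeriesMonomial K d = MvPowerSeries.monomial (Finsupp.equivFunOnFinite.symm d) 1 := by
  simp only [powerSeriesMonomial, MvPowerSeries.X_pow_eq, MvPowerSeries.prod_monomial,
    Finset.prod_const_one]
  congr 2
  ext j
  simp [Finsupp.finsetSum_apply, Finsupp.single_apply]

theorem constantCoeff_monomial {m : Fin n →₀ ℕ} (hm : m ≠ 0) (a : K) :
    MvPowerSeries.constantCoeff (MvPowerSeries.monomial m a) = 0 := by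
  rw [← MvPowerSeries.coeff_zero_eq_constantCoeff_apply]
  exact MvPowerSeries.coeff_monomial_ne hm.symm a

theorem constantCoeff_powerSeriesMonomial (hn : 1 ≤ n) {d : Fin n → ℕ} (hd : ∀ j, 1 ≤ d j) :
    MvPowerSeries.constantCoeff (powerSeriesMonomial K d) = 0 := by
  rw [powerSeriesMonomial_eq_monomial]
  refine constantCoeff_monomial (fun h => ?_) 1
  have := hd ⟨0, hn⟩
  have h0 : d ⟨0, hn⟩ = 0 := by simpa using DFunLike.congr_fun h ⟨0, hn⟩
  omega

theorem powerSeriesMonomial_mem_span_X (hn : 1 ≤ n) {d : Fin n → ℕ} (hd : ∀ j, 1 ≤ d j) :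
    powerSeriesMonomial K d ∈
      Ideal.span (Set.range (MvPowerSeries.X : Fin n → MvPowerSeries (Fin n) K)) :=
  Ideal.mem_of_dvd _
    ((dvd_pow_self _ (Nat.one_le_iff_ne_zero.1 (hd ⟨0, hn⟩))).trans
      (Finset.dvd_prod_of_mem (fun j => MvPowerSeries.X j ^ d j) (Finset.mem_univ (⟨0, hn⟩ : Fin n))))
    (Ideal.subset_span ⟨_, rfl⟩)

/-- Reduction of `S⟦z⟧ / (f + z ^ 2)`, with `S = K⟦x_1, …, x_n⟧`, modulo all the variables. -/
noncomputable def SharpRing.toField {f : MvPowerSeries (Fin n) K}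
    (hf : MvPowerSeries.constantCoeff f = 0) : SharpRing f →+* K :=
  Ideal.Quotient.lift _ (MvPowerSeries.constantCoeff.comp PowerSeries.constantCoeff) fun a ha => by
    obtain ⟨b, rfl⟩ := Ideal.mem_span_singleton.1 ha
    simp [hf]

theorem SharpRing.toField_algebraMap {f : MvPowerSeries (Fin n) K}
    (hf : MvPowerSeries.constantCoeff f = 0) (s : MvPowerSeries (Fin n) K) :
    toField hf (algebraMap _ _ s) = MvPowerSeries.constantCoeff s := by
  change MvPowerSeries.constantCoeff (PowerSeries.constantCoeff (PowerSeries.C s)) = _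
  simp

theorem SharpRing.toField_root {f : MvPowerSeries (Fin n) K}
    (hf : MvPowerSeries.constantCoeff f = 0) : toField hf (root f) = 0 := by
  change MvPowerSeries.constantCoeff (PowerSeries.constantCoeff PowerSeries.X) = _
  simp

theorem SharpRing.toField_surjective {f : MvPowerSeries (Fin n) K}
    (hf : MvPowerSeries.constantCoeff f = 0) : Function.Surjective (toField hf) := fun a =>
  ⟨algebraMap _ _ (MvPowerSeries.C a), by rw [toField_algebraMap]; simp⟩

end Monomial

/-! ### Matrix factorizations in the pushforward and the resulting free rank. -/

section FrobeniusDecomposition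

open Finset in
/-- The number of exponents `a` with `0 ≤ a_j < q` such that the carry of `a + h d` modulo `q` is
zero in all coordinates, or equal to `d` in all coordinates. -/
def carryCount {n : ℕ} (d : Fin n → ℕ) (q h : ℕ) : ℕ :=
  #{a : Fin n → Fin q | (∀ j, (a j + d j * h) / q = 0) ∨ ∀ j, (a j + d j * h) / q = d j}

variable {p : ℕ} [Fact p.Prime] {K : Type*} [Field K] [CharP K p]
  [FiniteDimensional (frobenius K p).fieldRange K] {n : ℕ} {d : Fin n → ℕ}

theorem finite_and_maxFreeRank_frobeniusPushforward (hn : 1 ≤ n) (hd : ∀ j, 1 ≤ d j)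
    [CharP (SharpRing (powerSeriesMonomial K d)) p] {e h : ℕ} (hh : p ^ e = 2 * h + 1) :
    Module.Finite (SharpRing (powerSeriesMonomial K d))
      (FrobeniusPushforward (SharpRing (powerSeriesMonomial K d)) p e) ∧
    maxFreeRank (SharpRing (powerSeriesMonomial K d))
      (FrobeniusPushforward (SharpRing (powerSeriesMonomial K d)) p e) =
      frobeniusDegree p K ^ e * carryCount d (p ^ e) h := by
  classical
  set f := powerSeriesMonomial K d with hf
  have hfm : f = MvPowerSeries.monomial (Finsupp.equivFunOnFinite.symm d) 1 :=
    powerSeriesMonomial_eq_monomial d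
  have hf0 : MvPowerSeries.constantCoeff f = 0 := constantCoeff_powerSeriesMonomial hn hd
  have hfI := powerSeriesMonomial_mem_span_X (K := K) hn hd
  have hspan := SharpRing.exists_eq_add_mul_root _ hfI
  have hindep := SharpRing.eq_zero_of_add_mul_root _ hfI
  have : NeZero (p ^ e) := ⟨by omega⟩
  have hq0 : 0 < p ^ e := Nat.pos_of_neZero _
  obtain ⟨l, hl⟩ := exists_basis_iterateFrobenius p K e
  have hμ := bijective_sum_pow_mul_monomial (n := n) hl
  set μ : Fin (frobeniusDegree p K ^ e) × (Fin n → Fin (p ^ e)) → MvPowerSeries (Fin n) K :=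
    fun i => MvPowerSeries.monomial (Finsupp.equivFunOnFinite.symm fun j => (i.2 j : ℕ)) (l i.1)
    with hμdef
  let σ : Equiv.Perm (Fin (frobeniusDegree p K ^ e) × (Fin n → Fin (p ^ e))) :=
    -- Multiplication by `f ^ h` adds `d j * h` to the exponents: `σ` records the remainders modulo
    -- `p ^ e`, and `α` below the quotients.
    Equiv.prodCongr (Equiv.refl _) (Equiv.addRight fun j => Fin.ofNat (p ^ e) (d j * h))
  let α : (Fin n → Fin (p ^ e)) → Fin n → ℕ := fun a j => (a j + d j * h) / p ^ e
  have hαd (a j) : α a j ≤ d j := by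
    apply Nat.le_of_lt_succ
    rw [Nat.div_lt_iff_lt_mul hq0, Nat.succ_mul]
    have h1 := (a j).2
    have h2 : d j * h ≤ d j * p ^ e := Nat.mul_le_mul_left _ (by omega)
    omega
  have hσ (i j) : p ^ e * α i.2 j + ((σ i).2 j : ℕ) = i.2 j + d j * h := by
    have : ((σ i).2 j : ℕ) = (i.2 j + d j * h) % p ^ e := by
      simp [σ, Fin.val_add]
    rw [this]
    exact Nat.div_add_mod _ _
  -- The two entries of each block multiply to `-f`. The signs survive extraction of `p ^ e`-th
  -- roots because `p ^ e` is odd.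
  let A : (Fin (frobeniusDegree p K ^ e) × (Fin n → Fin (p ^ e))) × Bool →
      MvPowerSeries (Fin n) K := fun k =>
    bif k.2 then MvPowerSeries.monomial
      (Finsupp.equivFunOnFinite.symm fun j => d j - α k.1.2 j) (-(-1) ^ h)
    else MvPowerSeries.monomial (Finsupp.equivFunOnFinite.symm (α k.1.2)) ((-1) ^ h)
  have hodd : Odd (p ^ e) := ⟨h, hh⟩
  have hnegf : -f = MvPowerSeries.monomial (Finsupp.equivFunOnFinite.symm d) (-1) := by
    rw [hfm, map_neg]
  have hsign : ((-1 : K) ^ h) ^ p ^ e = (-1) ^ h := by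
    rw [← pow_mul, mul_comm, pow_mul, hodd.neg_one_pow]
  have hAf (i) : (-f) ^ h * μ i = A (i, false) ^ p ^ e * μ (σ i) := by
    simp only [hnegf, A, cond_false, hμdef, MvPowerSeries.monomial_pow,
      MvPowerSeries.monomial_mul_monomial, hsign]
    congr 2
    ext j
    have := hσ i j
    simp only [Finsupp.add_apply, Finsupp.smul_apply, Finsupp.equivFunOnFinite_symm_apply_apply,
      smul_eq_mul]
    linarith
  -- The extra factor `-f` comes from `z * z`. The exponents match since `(h + 1) d + σ(a) = (2h +
  -- 1) d + a - q α = q (d - α) + a`, with `q = p ^ e`.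
  have hAt (i) : (-f) ^ (h + 1) * μ (σ i) = A (i, true) ^ p ^ e * μ i := by
    simp only [hnegf, A, cond_true, hμdef, MvPowerSeries.monomial_pow,
      MvPowerSeries.monomial_mul_monomial, hodd.neg_pow, hsign]
    congr 2
    · ext j
      have h1 := hσ i j
      obtain ⟨t, ht⟩ := Nat.exists_eq_add_of_le (hαd i.2 j)
      simp only [Finsupp.add_apply, Finsupp.smul_apply,
        Finsupp.equivFunOnFinite_symm_apply_apply, smul_eq_mul]
      have h2 : d j - α i.2 j = t := by omega
      rw [h2]
      have h3 : p ^ e * d j = p ^ e * α i.2 j + p ^ e * t := by rw [ht, mul_add]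
      have h4 : p ^ e * d j = 2 * (d j * h) + d j := by rw [hh]; ring
      linarith
    · ring
  let _ : Module (MvPowerSeries (Fin n) K) (FrobeniusPushforward (SharpRing f) p e) :=
    Module.compHom _ (algebraMap (MvPowerSeries (Fin n) K) (SharpRing f))
  have := IsScalarTower.of_algebraMap_smul (R := MvPowerSeries (Fin n) K) (A := SharpRing f)
    (M := FrobeniusPushforward (SharpRing f) p e) fun _ _ => rfl
  obtain ⟨b, hbf, hbt⟩ := exists_basis_frobeniusPushforward hspan hindep hμ σ
  have hzz := SharpRing.root_mul_root f
  have hzq : SharpRing.root f ^ p ^ e = algebraMap _ _ ((-f) ^ h) * SharpRing.root f := by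
    rw [hh, pow_succ, pow_mul, pow_two (SharpRing.root f), hzz, map_pow]
  have hb (i δ) : SharpRing.root f • b (i, δ) = A (i, δ) • b (i, !δ) := by
    cases δ
    · rw [Bool.not_false, hbf, hbt]
      change (SharpRing.root f ^ p ^ e * algebraMap _ _ (μ i) : SharpRing f) =
        algebraMap _ _ (A (i, false)) ^ p ^ e * (algebraMap _ _ (μ (σ i)) * SharpRing.root f)
      rw [hzq, ← mul_assoc, ← map_pow, ← map_mul, ← hAf, map_mul]
      ring
    · rw [Bool.not_true, hbf, hbt]
      change (SharpRing.root f ^ p ^ e * (algebraMap _ _ (μ (σ i)) * SharpRing.root f) :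
        SharpRing f) = algebraMap _ _ (A (i, true)) ^ p ^ e * algebraMap _ _ (μ i)
      rw [hzq, ← map_pow (algebraMap _ _), ← map_mul, ← hAt, pow_succ (-f) h, map_mul, map_mul]
      linear_combination (algebraMap _ _ ((-f) ^ h) * algebraMap _ _ (μ (σ i))) * hzz
  refine ⟨?_, ?_⟩
  · have := Module.Finite.of_basis b
    exact Module.Finite.of_restrictScalars_finite (MvPowerSeries (Fin n) K) _ _
  rw [maxFreeRank_eq_card (SharpRing.toField_surjective hf0) hzz hspan hindep
    (SharpRing.toField_root hf0) hb (Finset.univ ×ˢ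
      Finset.univ.filter fun a : Fin n → Fin (p ^ e) =>
        (∀ j, (a j + d j * h) / p ^ e = 0) ∨ ∀ j, (a j + d j * h) / p ^ e = d j),
    Finset.card_product, carryCount]
  · simp
  · rintro ⟨i, a⟩ ha
    simp only [Finset.mem_product, Finset.mem_univ, Finset.mem_filter, true_and] at ha
    have hu : IsUnit ((-1 : K) ^ h) := (isUnit_one.neg).pow h
    rcases ha with ha | ha
    · refine ⟨false, ?_⟩
      have : (Finsupp.equivFunOnFinite.symm (α a)) = 0 := by
        ext j
        exact ha j
      simp only [A, cond_false, this, MvPowerSeries.monomial_zero_eq_C_apply]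
      exact hu.map _
    · refine ⟨true, ?_⟩
      have : (Finsupp.equivFunOnFinite.symm fun j => d j - α a j) = 0 := by
        ext j
        simp [α, ha j]
      simp only [A, cond_true, this, MvPowerSeries.monomial_zero_eq_C_apply]
      exact hu.neg.map _
  · rintro ⟨i, a⟩ ha δ
    simp only [Finset.mem_product, Finset.mem_univ, Finset.mem_filter, true_and, not_or] at ha
    rw [SharpRing.toField_algebraMap]
    cases δ
    · refine constantCoeff_monomial (fun h0 => ha.1 fun j => ?_) _
      exact DFunLike.congr_fun h0 j
    · refine constantCoeff_monomial (fun h0 => ha.2 fun j => ?_) _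
      have h1 : d j - α a j = 0 := by simpa using DFunLike.congr_fun h0 j
      exact le_antisymm (hαd a j) (Nat.sub_eq_zero_iff_le.1 h1)

end FrobeniusDecomposition

/-! ### Counting the exponents that give free blocks. -/

section Counting

open Finset

theorem card_filter_forall {n q : ℕ} (P : Fin n → ℕ → Prop) [∀ j, DecidablePred (P j)] :
    #{a : Fin n → Fin q | ∀ j, P j (a j)} = ∏ j, #{x : Fin q | P j x} := by
  rw [← Fintype.card_piFinset]
  congr 1
  ext a
  simp

/-- In each coordinate the carry is `0` for the `h + 1` values `x ≤ h` and `1` for the other `h`.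
The two alternatives exclude each other because there is at least one coordinate. -/
theorem carryCount_of_eq_one {n : ℕ} (hn : 1 ≤ n) {d : Fin n → ℕ} (hd : ∀ j, d j = 1) (h : ℕ) :
    carryCount d (2 * h + 1) h = (h + 1) ^ n + h ^ n := by
  have h1 : #{x : Fin (2 * h + 1) | (x + h : ℕ) / (2 * h + 1) = 0} = h + 1 := by
    have : (univ.filter fun x : Fin (2 * h + 1) => (x + h : ℕ) / (2 * h + 1) = 0) =
        Finset.Iic ⟨h, by omega⟩ := by
      ext x
      simp only [mem_filter, mem_univ, true_and, mem_Iic, Fin.le_def, Nat.div_eq_zero_iff]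
      omega
    rw [this, Fin.card_Iic]
  have h2 : #{x : Fin (2 * h + 1) | (x + h : ℕ) / (2 * h + 1) = 1} = h := by
    have : (univ.filter fun x : Fin (2 * h + 1) => (x + h : ℕ) / (2 * h + 1) = 1) =
        Finset.Ioi ⟨h, by omega⟩ := by
      ext x
      have := x.2
      simp only [mem_filter, mem_univ, true_and, mem_Ioi, Fin.lt_def]
      rw [Nat.div_eq_iff (by omega)]
      omega
    rw [this, Fin.card_Ioi]
    simp only
    omega
  simp only [carryCount, hd, one_mul]
  rw [filter_or, card_union_of_disjoint, card_filter_forall fun _ x => (x + h) / (2 * h + 1) = 0,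
    card_filter_forall fun _ x => (x + h) / (2 * h + 1) = 1, prod_congr rfl fun _ _ => h1,
    prod_congr rfl fun _ _ => h2]
  · simp
  · rw [disjoint_filter]
    intro a _ h0 h1
    have := h0 ⟨0, hn⟩
    rw [h1] at this
    exact one_ne_zero this

/-- Since `d k * h ≥ 2 * h`, carry `0` at `k` forces `a k = 0`, while carry `d k` would need `a k ≥
d k * (h + 1) > 2 * h`. So coordinate `k` is fixed and the others are free. -/
theorem carryCount_le_of_two_le {n : ℕ} {d : Fin n → ℕ} {k : Fin n} (hk : 2 ≤ d k) (h : ℕ) :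
    carryCount d (2 * h + 1) h ≤ (2 * h + 1) ^ (n - 1) := by
  have hmul : 2 * h ≤ d k * h := Nat.mul_le_mul_right h hk
  have hsub : (univ.filter fun a : Fin n → Fin (2 * h + 1) =>
      (∀ j, (a j + d j * h) / (2 * h + 1) = 0) ∨ ∀ j, (a j + d j * h) / (2 * h + 1) = d j) ⊆
      Fintype.piFinset fun j => if j = k then {0} else univ := by
    intro a ha
    rw [Fintype.mem_piFinset]
    intro j
    split_ifs with hj
    · subst hj
      rw [mem_singleton]
      have hlt := (a j).2
      rcases (mem_filter.1 ha).2 with h0 | h0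
      · have := (Nat.div_eq_zero_iff.1 (h0 j)).resolve_left (by omega)
        ext
        simp only [Fin.val_zero]
        omega
      · exfalso
        have := Nat.div_mul_le_self (a j + d j * h : ℕ) (2 * h + 1)
        rw [h0 j] at this
        have h3 : d j * (2 * h + 1) = 2 * (d j * h) + d j := by ring
        omega
    · exact mem_univ _
  refine (card_le_card hsub).trans ?_
  rw [Fintype.card_piFinset, ← mul_prod_erase univ _ (mem_univ k)]
  rw [prod_congr rfl (g := fun _ => 2 * h + 1)]
  · simp [card_erase_of_mem]
  · intro j hj
    simp [(mem_erase.1 hj).1]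

end Counting

/-! ### Asymptotics of the count. -/

section Limits

open Filter

theorem tendsto_carryCount_of_eq_one {n : ℕ} (hn : 1 ≤ n) {d : Fin n → ℕ} (hd : ∀ j, d j = 1)
    {q h : ℕ → ℕ} (hq : Tendsto q atTop atTop) (hh : ∀ e, q e = 2 * h e + 1) :
    Tendsto (fun e => (carryCount d (q e) (h e) : ℝ) / (q e : ℝ) ^ n) atTop
      (𝓝 (1 / 2 ^ (n - 1))) := by
  have hinv : Tendsto (fun e => ((q e : ℕ) : ℝ)⁻¹) atTop (𝓝 0) :=
    tendsto_inv_atTop_zero.comp (tendsto_natCast_atTop_atTop.comp hq)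
  -- Here `h + 1 = (q + 1) / 2` and `h = (q - 1) / 2`, each divided by `q`.
  have hlim : Tendsto (fun e => ((1 + (q e : ℝ)⁻¹) / 2) ^ n + ((1 - (q e : ℝ)⁻¹) / 2) ^ n) atTop
      (𝓝 (((1 + 0) / 2) ^ n + ((1 - 0) / 2) ^ n)) :=
    (((tendsto_const_nhds.add hinv).div_const 2).pow n).add
      (((tendsto_const_nhds.sub hinv).div_const 2).pow n)
  convert! hlim using 1
  · funext e
    have hq0 : (q e : ℝ) = 2 * h e + 1 := by rw [hh]; push_cast; rfl
    have hpos : (0 : ℝ) < 2 * h e + 1 := by positivity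
    conv_lhs => rw [hh e, carryCount_of_eq_one hn hd, ← hh e]
    push_cast
    rw [hq0, add_div, ← div_pow, ← div_pow]
    congr 2 <;> field_simp <;> ring
  · obtain ⟨m, rfl⟩ := Nat.exists_eq_add_of_le' hn
    simp only [Nat.add_sub_cancel, add_zero, sub_zero, pow_succ, one_div, inv_pow]
    ring_nf

theorem tendsto_carryCount_of_two_le {n : ℕ} {d : Fin n → ℕ} {k : Fin n} (hk : 2 ≤ d k)
    {q h : ℕ → ℕ} (hq : Tendsto q atTop atTop) (hh : ∀ e, q e = 2 * h e + 1) :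
    Tendsto (fun e => (carryCount d (q e) (h e) : ℝ) / (q e : ℝ) ^ n) atTop (𝓝 0) := by
  have hinv : Tendsto (fun e => ((q e : ℕ) : ℝ)⁻¹) atTop (𝓝 0) :=
    tendsto_inv_atTop_zero.comp (tendsto_natCast_atTop_atTop.comp hq)
  refine squeeze_zero (fun e => by positivity) (fun e => ?_) hinv
  have hpos : (0 : ℝ) < q e := by rw [hh]; positivity
  have hle : (carryCount d (q e) (h e) : ℝ) ≤ (q e : ℝ) ^ (n - 1) := by
    have := carryCount_le_of_two_le hk (h e)
    rw [← hh e] at this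
    exact_mod_cast this
  have hn : n - 1 + 1 = n := Nat.sub_add_cancel (Fin.pos k)
  have hpow : (q e : ℝ)⁻¹ * (q e : ℝ) ^ n = (q e : ℝ) ^ (n - 1) := by
    conv_lhs => rw [← hn, pow_succ', inv_mul_cancel_left₀ hpos.ne']
  rwa [div_le_iff₀ (by positivity), hpow]

end Limits

/-! ### Assembling the F-signature. -/

section FSignature

variable {p : ℕ} [Fact p.Prime] {K : Type*} [Field K] [CharP K p]
  [FiniteDimensional (frobenius K p).fieldRange K] {n : ℕ} {d : Fin n → ℕ}

theorem isLocalRing_sharpRing {S : Type*} [CommRing S] [IsLocalRing S] {f : S}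
    [Nontrivial (SharpRing f)] : IsLocalRing (SharpRing f) :=
  IsLocalRing.of_surjective' (Ideal.Quotient.mk _) Ideal.Quotient.mk_surjective

/-- The F-signature of `K⟦x_1, …, x_n⟧⟦z⟧ / (x_1 ^ d_1 ⋯ x_n ^ d_n + z ^ 2)` is the limit of the
proportion of exponents counted by `carryCount`. -/
theorem hasFSignature_sharpRing (hn : 1 ≤ n) (hd : ∀ j, 1 ≤ d j) {h : ℕ → ℕ}
    (hh : ∀ e, p ^ e = 2 * h e + 1) {s : ℝ}
    (hs : Filter.Tendsto
      (fun e => (carryCount d (p ^ e) (h e) : ℝ) / ((p ^ e : ℕ) : ℝ) ^ n) Filter.atTop (𝓝 s)) :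
    HasFSignature p (SharpRing (powerSeriesMonomial K d)) s := by
  have hf0 := constantCoeff_powerSeriesMonomial (K := K) hn hd
  have : Nontrivial (SharpRing (powerSeriesMonomial K d)) :=
    (SharpRing.toField hf0).domain_nontrivial
  have hlocal : IsLocalRing (SharpRing (powerSeriesMonomial K d)) := isLocalRing_sharpRing
  have hchar : CharP (SharpRing (powerSeriesMonomial K d)) p :=
    charP_of_injective_ringHom ((algebraMap (MvPowerSeries (Fin n) K) _).comp MvPowerSeries.C :
      K →+* SharpRing (powerSeriesMonomial K d)).injective p
  have : IsDomain (MvPowerSeries (Fin n) K) := NoZeroDivisors.to_isDomain _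
  have hfm : powerSeriesMonomial K d ∈ IsLocalRing.maximalIdeal (MvPowerSeries (Fin n) K) := by
    rw [IsLocalRing.mem_maximalIdeal, mem_nonunits_iff, MvPowerSeries.isUnit_iff_constantCoeff,
      hf0]
    exact not_isUnit_zero
  refine ⟨hlocal, hchar, n, inferInstance,
    (finite_and_maxFreeRank_frobeniusPushforward hn hd (hh 1)).1, ?_, ?_⟩
  · rw [ringKrullDim_sharpRing hfm, ringKrullDim_mvPowerSeries_fin]
  have hπ := SharpRing.toField_surjective hf0
  have : IsLocalHom (SharpRing.toField hf0) := IsLocalHom.of_surjective _ hπ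
  -- The residue field is `K`, so `α(R)` is computed from `[K : K ^ p]`.
  have hres : Function.Bijective (IsLocalRing.ResidueField.lift (SharpRing.toField hf0)) :=
    ⟨RingHom.injective _, fun a => (hπ a).imp' (IsLocalRing.residue _) fun _ ha => ha⟩
  rw [frobeniusDegree_congr p (RingEquiv.ofBijective _ hres)]
  have hD : (0 : ℝ) < frobeniusDegree p K := by exact_mod_cast frobeniusDegree_pos p K
  have hp1 : (1 : ℝ) < p := by exact_mod_cast (Fact.out : p.Prime).one_lt
  have hp0 : (0 : ℝ) < p := by linarith
  convert! hs using 2 with e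
  -- With `D = [K : K ^ p]`, the factor `p ^ (e * logb p D)` equals `D ^ e` and cancels against the
  -- same factor in the free rank.
  rw [(finite_and_maxFreeRank_frobeniusPushforward hn hd (hh e)).2, mul_add, Real.rpow_add hp0,
    mul_comm (e : ℝ) (Real.logb _ _), Real.rpow_mul hp0.le (Real.logb _ _),
    Real.rpow_logb hp0 hp1.ne' hD, Real.rpow_natCast, ← Nat.cast_mul, Real.rpow_natCast, pow_mul]
  push_cast
  rw [mul_comm (_ ^ n)]
  exact mul_div_mul_left _ _ (pow_pos hD e).ne'

end FSignature

theorem theorem6p9 (p : ℕ) [Fact p.Prime] (hp : 2 < p) (K : Type*) [Field K] [CharP K p]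
    [FiniteDimensional (frobenius K p).fieldRange K] (n : ℕ) (hn : 1 ≤ n)
    (d : Fin n → ℕ) (hd : ∀ j, 1 ≤ d j) :
    ((∀ j, d j = 1) →
      HasFSignature p (SharpRing (powerSeriesMonomial K d)) (1 / 2 ^ (n - 1))) ∧
    (2 ≤ Finset.univ.sup d →
      HasFSignature p (SharpRing (powerSeriesMonomial K d)) 0) := by
  have hodd : Odd p := (Fact.out : p.Prime).odd_of_ne_two hp.ne'
  choose h hh using fun e : ℕ => hodd.pow (n := e)
  have hq : Filter.Tendsto (fun e => p ^ e) Filter.atTop Filter.atTop :=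
    tendsto_pow_atTop_atTop_of_one_lt (Fact.out : p.Prime).one_lt
  refine ⟨fun h1 => hasFSignature_sharpRing hn hd hh (tendsto_carryCount_of_eq_one hn h1 hq hh),
    fun h2 => ?_⟩
  obtain ⟨k, -, hk⟩ := (Finset.le_sup_iff two_pos).1 h2
  exact hasFSignature_sharpRing hn hd hh (tendsto_carryCount_of_two_le hk hq hh)
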